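/- A Banach lattice homomorphism is a bounded linear operator between Banach lattices that preserves binary suprema and infima. A Banach lattice $P$ is called projective if, whenever $X$ is a Banach lattice, $J$ a closed ideal of $X$ and $Q:X\to X/J$ the quotient map, then for every Banach lattice homomorphism $T:P\to X/J$ and every $\varepsilon>0$ there is a Banach lattice homomorphism $\hat T:P\to X$ with $Q\circ\hat T=T$ and $\|\hat T\|\le(1+\varepsilon)\|T\|$. For a lattice $\mathbb{L}$ let $\mathbb{L}^*$ be the set of all lattice homomorphisms $x^*:\mathbb{L}\to[-1,1]$, for $f:\mathbb{L}^*\to\mathbb{R}$ let $$\|f\|_*=\sup\Big\{\sum_{i=1}^n|r_if(x_i^*)| : n\in\mathbb{N},\ r_i\in\mathbb{R},\ x_i^*\in\mathbb{L}^*,\ \sup_{x\in\mathbb{L}}\sum_{i=1}^n|r_ix_i^*(x)|\le1\Big\},$$ and let $FBL_*\langle\mathbb{L}\rangle$ be the Banach lattice (that is, the smallest closed vector sublattice) generated by the evaluations $\dot\delta_x:x^*\mapsto x^*(x)$, $x\in\mathbb{L}$, inside the Banach lattice of all functions $f:\mathbb{L}^*\to\mathbb{R}$ with $\|f\|_*<\infty$,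 with the norm $\|\cdot\|_*$ and the pointwise operations. Theorem 4.4. Let $\mathbb{L}$ be an infinite linearly ordered set that contains either a strictly increasing sequence with no upper bound in $\mathbb{L}$ or a strictly decreasing sequence with no lower bound in $\mathbb{L}$. Then $FBL_*\langle\mathbb{L}\rangle$ is not projective. -/

import Mathlib

open scoped ENNReal

universe u v

/-- A (real) Banach lattice: a complete normed space with a lattice order that is compatible with
addition and with multiplication by nonnegative scalars, whose norm satisfies
`|x| ≤ |y| → ‖x‖ ≤ ‖y‖`. -/
class IsBanachLattice (X : Type*) [NormedAddCommGroup X] [NormedSpace ℝ X] [Lattice X] : Prop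
    extends IsOrderedAddMonoid X, IsOrderedModule ℝ X, HasSolidNorm X, CompleteSpace X

/-- A bounded linear operator that preserves binary suprema and infima, that is, a Banach lattice
homomorphism. -/
def IsBLHom {X Y : Type*} [NormedAddCommGroup X] [NormedSpace ℝ X] [Lattice X]
    [NormedAddCommGroup Y] [NormedSpace ℝ Y] [Lattice Y] (T : X →L[ℝ] Y) : Prop :=
  (∀ x y, T (x ⊔ y) = T x ⊔ T y) ∧ ∀ x y, T (x ⊓ y) = T x ⊓ T y

/-! ### Closed ideals and quotients -/

/-- A closed (order) ideal of a Banach lattice: a closed, solid linear subspace. -/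
structure ClosedIdeal (X : Type*) [NormedAddCommGroup X] [NormedSpace ℝ X] [Lattice X]
    extends Submodule ℝ X where
  isClosed' : IsClosed carrier
  solid' : LatticeOrderedAddCommGroup.IsSolid carrier

namespace ClosedIdeal

variable {X : Type*} [NormedAddCommGroup X] [NormedSpace ℝ X] [Lattice X]

/-- The quotient `X / J`, with the quotient norm and the quotient order. -/
def Quot (J : ClosedIdeal X) : Type _ := X ⧸ J.toSubmodule

variable (J : ClosedIdeal X)

instance isClosed_toSubmodule : IsClosed (J.toSubmodule : Set X) := J.isClosed'

noncomputable instance : NormedAddCommGroup J.Quot :=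
  inferInstanceAs (NormedAddCommGroup (X ⧸ J.toSubmodule))

noncomputable instance : NormedSpace ℝ J.Quot :=
  inferInstanceAs (NormedSpace ℝ (X ⧸ J.toSubmodule))

/-- The quotient map `X → X / J`. -/
noncomputable def proj : X →L[ℝ] J.Quot := J.toSubmodule.mkQL

theorem proj_surjective : Function.Surjective J.proj := Submodule.Quotient.mk_surjective _

theorem proj_eq_iff {x y : X} : J.proj x = J.proj y ↔ x - y ∈ J.toSubmodule :=
  Submodule.Quotient.eq J.toSubmodule

theorem norm_proj_le (x : X) : ‖J.proj x‖ ≤ ‖x‖ := Submodule.Quotient.norm_mk_le J.toSubmodule x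

theorem exists_norm_lt (a : J.Quot) {r : ℝ} (h : ‖a‖ < r) : ∃ x, J.proj x = a ∧ ‖x‖ < r :=
  QuotientAddGroup.norm_lt_iff.1 h

theorem mem_of_abs_le {x y : X} (hx : x ∈ J.toSubmodule) (h : |y| ≤ |x|) : y ∈ J.toSubmodule :=
  J.solid' hx h

variable [IsBanachLattice X]

theorem abs_mem {x : X} (hx : x ∈ J.toSubmodule) : |x| ∈ J.toSubmodule :=
  J.mem_of_abs_le hx (abs_abs x).le

theorem proj_sup_congr {a b c d : X} (h₁ : J.proj a = J.proj c) (h₂ : J.proj b = J.proj d) :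
    J.proj (a ⊔ b) = J.proj (c ⊔ d) := by
  rw [proj_eq_iff] at *
  refine J.mem_of_abs_le (J.add_mem (J.abs_mem h₁) (J.abs_mem h₂)) ?_
  rw [abs_of_nonneg (add_nonneg (abs_nonneg (a - c)) (abs_nonneg (b - d)))]
  calc |a ⊔ b - c ⊔ d| = |(a ⊔ b - c ⊔ b) + (c ⊔ b - c ⊔ d)| := by rw [sub_add_sub_cancel]
    _ ≤ |a ⊔ b - c ⊔ b| + |c ⊔ b - c ⊔ d| := abs_add_le _ _
    _ ≤ |a - c| + |b - d| := by
      refine add_le_add (abs_sup_sub_sup_le_abs _ _ _) ?_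
      rw [sup_comm c, sup_comm c]
      exact abs_sup_sub_sup_le_abs _ _ _

theorem proj_inf_congr {a b c d : X} (h₁ : J.proj a = J.proj c) (h₂ : J.proj b = J.proj d) :
    J.proj (a ⊓ b) = J.proj (c ⊓ d) := by
  rw [proj_eq_iff] at *
  refine J.mem_of_abs_le (J.add_mem (J.abs_mem h₁) (J.abs_mem h₂)) ?_
  rw [abs_of_nonneg (add_nonneg (abs_nonneg (a - c)) (abs_nonneg (b - d)))]
  calc |a ⊓ b - c ⊓ d| = |(a ⊓ b - c ⊓ b) + (c ⊓ b - c ⊓ d)| := by rw [sub_add_sub_cancel]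
    _ ≤ |a ⊓ b - c ⊓ b| + |c ⊓ b - c ⊓ d| := abs_add_le _ _
    _ ≤ |a - c| + |b - d| := by
      refine add_le_add (abs_inf_sub_inf_le_abs _ _ _) ?_
      rw [inf_comm c, inf_comm c]
      exact abs_inf_sub_inf_le_abs _ _ _

noncomputable instance : Max J.Quot :=
  ⟨fun a b => J.proj (Function.surjInv J.proj_surjective a ⊔ Function.surjInv J.proj_surjective b)⟩

noncomputable instance : Min J.Quot :=
  ⟨fun a b => J.proj (Function.surjInv J.proj_surjective a ⊓ Function.surjInv J.proj_surjective b)⟩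

theorem proj_sup (x y : X) : J.proj (x ⊔ y) = J.proj x ⊔ J.proj y :=
  J.proj_sup_congr (Function.surjInv_eq J.proj_surjective _).symm
    (Function.surjInv_eq J.proj_surjective _).symm

theorem proj_inf (x y : X) : J.proj (x ⊓ y) = J.proj x ⊓ J.proj y :=
  J.proj_inf_congr (Function.surjInv_eq J.proj_surjective _).symm
    (Function.surjInv_eq J.proj_surjective _).symm

/-- The quotient lattice structure: the lattice operations are those of representatives, and
`a ≤ b` means `a ⊔ b = b` (equivalently, `a` and `b` have representatives `x ≤ y`; see
`proj_le_iff` below). -/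
noncomputable instance : Lattice J.Quot :=
  Lattice.mk'
    (fun a b => by
      obtain ⟨x, rfl⟩ := J.proj_surjective a
      obtain ⟨y, rfl⟩ := J.proj_surjective b
      rw [← proj_sup, ← proj_sup, sup_comm])
    (fun a b c => by
      obtain ⟨x, rfl⟩ := J.proj_surjective a
      obtain ⟨y, rfl⟩ := J.proj_surjective b
      obtain ⟨z, rfl⟩ := J.proj_surjective c
      rw [← proj_sup, ← proj_sup, ← proj_sup, ← proj_sup, sup_assoc])
    (fun a b => by
      obtain ⟨x, rfl⟩ := J.proj_surjective a
      obtain ⟨y, rfl⟩ := J.proj_surjective b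
      rw [← proj_inf, ← proj_inf, inf_comm])
    (fun a b c => by
      obtain ⟨x, rfl⟩ := J.proj_surjective a
      obtain ⟨y, rfl⟩ := J.proj_surjective b
      obtain ⟨z, rfl⟩ := J.proj_surjective c
      rw [← proj_inf, ← proj_inf, ← proj_inf, ← proj_inf, inf_assoc])
    (fun a b => by
      obtain ⟨x, rfl⟩ := J.proj_surjective a
      obtain ⟨y, rfl⟩ := J.proj_surjective b
      rw [← proj_inf, ← proj_sup, sup_inf_self])
    (fun a b => by
      obtain ⟨x, rfl⟩ := J.proj_surjective a
      obtain ⟨y, rfl⟩ := J.proj_surjective b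
      rw [← proj_sup, ← proj_inf, inf_sup_self])

theorem isBLHom_proj : IsBLHom J.proj := ⟨J.proj_sup, J.proj_inf⟩

theorem proj_mono {x y : X} (h : x ≤ y) : J.proj x ≤ J.proj y := by
  rw [← sup_eq_right, ← proj_sup, sup_eq_right.2 h]

theorem proj_le_iff {a b : J.Quot} : a ≤ b ↔ ∃ x y, x ≤ y ∧ J.proj x = a ∧ J.proj y = b := by
  constructor
  · intro h
    obtain ⟨x, rfl⟩ := J.proj_surjective a
    obtain ⟨y, rfl⟩ := J.proj_surjective b
    exact ⟨x, x ⊔ y, le_sup_left, rfl, by rw [proj_sup, sup_eq_right.2 h]⟩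
  · rintro ⟨x, y, h, rfl, rfl⟩
    exact J.proj_mono h

theorem proj_abs (x : X) : J.proj |x| = |J.proj x| := by
  simp only [abs, proj_sup, map_neg]

/-- The quotient of a Banach lattice by a closed ideal is a Banach lattice. -/
instance : IsBanachLattice J.Quot where
  add_le_add_left a b h c := by
    obtain ⟨x, y, hxy, rfl, rfl⟩ := J.proj_le_iff.1 h
    obtain ⟨z, rfl⟩ := J.proj_surjective c
    rw [← map_add, ← map_add]
    exact J.proj_mono (add_le_add_left hxy z)
  smul_le_smul_of_nonneg_left r hr a b h := by
    obtain ⟨x, y, hxy, rfl, rfl⟩ := J.proj_le_iff.1 h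
    rw [← map_smul, ← map_smul]
    exact J.proj_mono (smul_le_smul_of_nonneg_left hxy hr)
  smul_le_smul_of_nonneg_right b hb r s h := by
    obtain ⟨x, y, h', hx, rfl⟩ := J.proj_le_iff.1 hb
    have h0 : J.proj (x ⊔ 0 ⊔ y) = J.proj y := by
      rw [proj_sup, proj_sup, hx, map_zero, sup_idem, sup_eq_right.2 hb]
    rw [← h0, ← map_smul, ← map_smul]
    exact J.proj_mono (smul_le_smul_of_nonneg_right h (le_sup_right.trans le_sup_left))
  solid a b h := by
    obtain ⟨x, rfl⟩ := J.proj_surjective a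
    refine le_of_forall_gt fun r hr => ?_
    obtain ⟨y, rfl, hy⟩ := J.exists_norm_lt b hr
    have h1 : J.proj ((x ⊓ |y|) ⊔ -|y|) = J.proj x := by
      rw [proj_sup, proj_inf, map_neg, proj_abs]
      have h2 : J.proj x ≤ |J.proj y| := (le_sup_left : J.proj x ≤ |J.proj x|).trans h
      have h3 : -|J.proj y| ≤ J.proj x := by
        rw [proj_le_iff]
        have h4 : -J.proj x ≤ |J.proj y| := (le_sup_right : -J.proj x ≤ |J.proj x|).trans h
        obtain ⟨u, v, huv, hu, hv⟩ := J.proj_le_iff.1 h4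
        exact ⟨-v, -u, neg_le_neg huv, by rw [map_neg, hv], by rw [map_neg, hu, neg_neg]⟩
      rw [inf_eq_left.2 h2, sup_eq_left.2 h3]
    rw [← h1]
    refine (J.norm_proj_le _).trans_lt (lt_of_le_of_lt (HasSolidNorm.solid ?_) hy)
    refine sup_le (sup_le inf_le_right ?_) ?_
    · exact (neg_nonpos.2 (abs_nonneg y)).trans (abs_nonneg y)
    · exact neg_le.1 le_sup_right
  toCompleteSpace := inferInstanceAs (CompleteSpace (X ⧸ J.toSubmodule))

end ClosedIdeal

/-- A Banach lattice `P` is projective if for every Banach lattice `X`, every closed ideal `J` of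
`X`, every Banach lattice homomorphism `T : P → X / J` and every `ε > 0` there is a Banach lattice
homomorphism `S : P → X` lifting `T` with `‖S‖ ≤ (1 + ε) ‖T‖`. -/
def IsProjectiveBL (P : Type u) [NormedAddCommGroup P] [NormedSpace ℝ P] [Lattice P]
    [IsBanachLattice P] : Prop :=
  ∀ (X : Type v) [NormedAddCommGroup X] [NormedSpace ℝ X] [Lattice X] [IsBanachLattice X]
    (J : ClosedIdeal X) (T : P →L[ℝ] J.Quot), IsBLHom T → ∀ ε : ℝ, 0 < ε →
      ∃ S : P →L[ℝ] X, IsBLHom S ∧ J.proj.comp S = T ∧ ‖S‖ ≤ (1 + ε) * ‖T‖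

/-! ### The Banach lattice generated by a subset -/

/-- A closed vector sublattice of a Banach lattice. -/
structure ClosedSublattice (X : Type*) [NormedAddCommGroup X] [NormedSpace ℝ X] [Lattice X]
    extends Submodule ℝ X where
  sup_mem' : ∀ ⦃x y⦄, x ∈ carrier → y ∈ carrier → x ⊔ y ∈ carrier
  inf_mem' : ∀ ⦃x y⦄, x ∈ carrier → y ∈ carrier → x ⊓ y ∈ carrier
  isClosed' : IsClosed carrier

namespace ClosedSublattice

variable {X : Type*} [NormedAddCommGroup X] [NormedSpace ℝ X] [Lattice X]

/-- A closed vector sublattice regarded as a space of its own. -/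
def Carrier (V : ClosedSublattice X) : Type _ := V.toSubmodule

variable (V : ClosedSublattice X)

noncomputable instance : NormedAddCommGroup V.Carrier :=
  inferInstanceAs (NormedAddCommGroup V.toSubmodule)

noncomputable instance : NormedSpace ℝ V.Carrier :=
  inferInstanceAs (NormedSpace ℝ V.toSubmodule)

instance : Lattice V.Carrier :=
  Subtype.lattice (P := fun x => x ∈ V.toSubmodule) (fun _ _ h₁ h₂ => V.sup_mem' h₁ h₂)
    (fun _ _ h₁ h₂ => V.inf_mem' h₁ h₂)

/-- The inclusion map. -/
noncomputable def incl : V.Carrier →L[ℝ] X := V.toSubmodule.subtypeL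

theorem incl_mem (x : V.Carrier) : V.incl x ∈ V.toSubmodule := Subtype.property x

theorem incl_injective : Function.Injective V.incl := Subtype.val_injective

theorem incl_le_incl {x y : V.Carrier} : V.incl x ≤ V.incl y ↔ x ≤ y := Iff.rfl

theorem norm_incl (x : V.Carrier) : ‖V.incl x‖ = ‖x‖ := rfl

theorem isBLHom_incl : IsBLHom V.incl := ⟨fun _ _ => rfl, fun _ _ => rfl⟩

instance [IsBanachLattice X] : IsBanachLattice V.Carrier where
  add_le_add_left a b h c := by
    rw [← incl_le_incl] at *
    rw [map_add, map_add]
    exact add_le_add_left h _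
  smul_le_smul_of_nonneg_left r hr a b h := by
    rw [← incl_le_incl] at *
    rw [map_smul, map_smul]
    exact smul_le_smul_of_nonneg_left h hr
  smul_le_smul_of_nonneg_right b hb r s h := by
    rw [← incl_le_incl] at *
    rw [map_smul, map_smul]
    rw [map_zero] at hb
    exact smul_le_smul_of_nonneg_right h hb
  solid a b h := by
    have h' : |V.incl a| ≤ |V.incl b| := h
    have h'' : ‖V.incl a‖ ≤ ‖V.incl b‖ := HasSolidNorm.solid h'
    rwa [norm_incl, norm_incl] at h''
  toCompleteSpace := V.isClosed'.completeSpace_coe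

/-- The Banach lattice generated by `S` inside `X`: the smallest closed vector sublattice of `X`
containing `S`. -/
def generated (S : Set X) : ClosedSublattice X where
  toSubmodule := sInf {W | ∃ V : ClosedSublattice X, V.toSubmodule = W ∧ S ⊆ W}
  sup_mem' x y hx hy := by
    simp only [AddSubsemigroup.mem_carrier, AddSubmonoid.mem_toSubsemigroup,
      Submodule.mem_toAddSubmonoid, Submodule.mem_sInf] at *
    rintro W ⟨V, rfl, hS⟩
    exact V.sup_mem' (hx _ ⟨V, rfl, hS⟩) (hy _ ⟨V, rfl, hS⟩)
  inf_mem' x y hx hy := by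
    simp only [AddSubsemigroup.mem_carrier, AddSubmonoid.mem_toSubsemigroup,
      Submodule.mem_toAddSubmonoid, Submodule.mem_sInf] at *
    rintro W ⟨V, rfl, hS⟩
    exact V.inf_mem' (hx _ ⟨V, rfl, hS⟩) (hy _ ⟨V, rfl, hS⟩)
  isClosed' := by
    have : ((sInf {W | ∃ V : ClosedSublattice X, V.toSubmodule = W ∧ S ⊆ W} : Submodule ℝ X) :
        Set X) = ⋂ W ∈ {W : Submodule ℝ X | ∃ V : ClosedSublattice X, V.toSubmodule = W ∧ S ⊆ W},
          (W : Set X) := Submodule.coe_sInf _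
    change IsClosed ((sInf {W | ∃ V : ClosedSublattice X, V.toSubmodule = W ∧ S ⊆ W} :
      Submodule ℝ X) : Set X)
    rw [this]
    refine isClosed_biInter ?_
    rintro W ⟨V, rfl, -⟩
    exact V.isClosed'

theorem subset_generated (S : Set X) : S ⊆ (generated S).toSubmodule := by
  intro x hx
  refine (Submodule.mem_sInf).2 ?_
  rintro W ⟨V, rfl, hS⟩
  exact hS hx

theorem generated_le {S : Set X} {V : ClosedSublattice X} (h : S ⊆ V.toSubmodule) :
    (generated S).toSubmodule ≤ V.toSubmodule :=
  sInf_le ⟨V, rfl, h⟩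

end ClosedSublattice

/-! ### The free Banach lattice of a lattice, as a space of functions -/

section FunctionSpace

variable {A : Type*} (K : Set (A → Set.Icc (-1 : ℝ) 1))

/-- For a set `K` of functions `A → [-1, 1]` and `f : K → ℝ`, the supremum in `[0, ∞]` of the sums
`∑ |r_i f(x_i)|` over all finite families of reals `r_i` and of points `x_i` of `K` with
`sup_a ∑ |r_i x_i(a)| ≤ 1`. -/
noncomputable def freeENorm (f : K → ℝ) : ℝ≥0∞ :=
  ⨆ (n : ℕ) (r : Fin n → ℝ) (x : Fin n → K)
    (_ : ∀ a : A, ∑ i, |r i * ((x i).1 a : ℝ)| ≤ 1), ∑ i, ENNReal.ofReal |r i * f (x i)|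

variable {K}

theorem le_freeENorm (f : K → ℝ) {n : ℕ} {r : Fin n → ℝ} {x : Fin n → K}
    (h : ∀ a : A, ∑ i, |r i * ((x i).1 a : ℝ)| ≤ 1) :
    ∑ i, ENNReal.ofReal |r i * f (x i)| ≤ freeENorm K f :=
  le_iSup_of_le n <| le_iSup_of_le r <| le_iSup_of_le x <| le_iSup_of_le h le_rfl

theorem freeENorm_le {f : K → ℝ} {c : ℝ≥0∞}
    (h : ∀ (n : ℕ) (r : Fin n → ℝ) (x : Fin n → K),
      (∀ a : A, ∑ i, |r i * ((x i).1 a : ℝ)| ≤ 1) → ∑ i, ENNReal.ofReal |r i * f (x i)| ≤ c) :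
    freeENorm K f ≤ c :=
  iSup_le fun n => iSup_le fun r => iSup_le fun x => iSup_le fun hx => h n r x hx

theorem freeENorm_mono {f g : K → ℝ} (h : ∀ x, |f x| ≤ |g x|) :
    freeENorm K f ≤ freeENorm K g := by
  refine freeENorm_le fun n r x hx => le_trans ?_ (le_freeENorm g hx)
  refine Finset.sum_le_sum fun i _ => ENNReal.ofReal_le_ofReal ?_
  rw [abs_mul, abs_mul]
  exact mul_le_mul_of_nonneg_left (h _) (abs_nonneg _)

theorem freeENorm_add_le (f g : K → ℝ) :
    freeENorm K (f + g) ≤ freeENorm K f + freeENorm K g := by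
  refine freeENorm_le fun n r x hx =>
    le_trans ?_ (add_le_add (le_freeENorm f hx) (le_freeENorm g hx))
  rw [← Finset.sum_add_distrib]
  refine Finset.sum_le_sum fun i _ => ?_
  rw [← ENNReal.ofReal_add (abs_nonneg _) (abs_nonneg _)]
  refine ENNReal.ofReal_le_ofReal ?_
  rw [Pi.add_apply, mul_add]
  exact abs_add_le _ _

theorem freeENorm_smul_le (c : ℝ) (f : K → ℝ) :
    freeENorm K (c • f) ≤ ENNReal.ofReal |c| * freeENorm K f := by
  refine freeENorm_le fun n r x hx =>
    le_trans ?_ (mul_le_mul_right (le_freeENorm f hx) _)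
  rw [Finset.mul_sum]
  refine Finset.sum_le_sum fun i _ => ?_
  rw [← ENNReal.ofReal_mul (abs_nonneg _), ← abs_mul, Pi.smul_apply, smul_eq_mul, mul_left_comm]

theorem freeENorm_zero : freeENorm K (0 : K → ℝ) = 0 :=
  le_antisymm (freeENorm_le fun n r x _ => by simp) bot_le

theorem ofReal_abs_le_freeENorm (f : K → ℝ) (x : K) :
    ENNReal.ofReal |f x| ≤ freeENorm K f := by
  have h := le_freeENorm f (n := 1) (r := fun _ => 1) (x := fun _ => x) fun a => by
    have h2 := abs_le.2 (x.1 a).2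
    simpa using h2
  simpa using h

/-- The evaluation function `x ↦ x(a)` on `K`. -/
def evalFun (K : Set (A → Set.Icc (-1 : ℝ) 1)) (a : A) : K → ℝ := fun x => (x.1 a : ℝ)

theorem freeENorm_evalFun_le (a : A) : freeENorm K (evalFun K a) ≤ 1 := by
  refine freeENorm_le fun n r x hx => ?_
  rw [← ENNReal.ofReal_sum_of_nonneg fun i _ => abs_nonneg _]
  exact ENNReal.ofReal_le_one.2 (hx a)

variable (K)

/-- The vector space of the functions `f : K → ℝ` with `freeENorm K f < ∞`. -/
def finNormSubmodule : Submodule ℝ (K → ℝ) where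
  carrier := {f | freeENorm K f < ∞}
  zero_mem' := by simp [freeENorm_zero]
  add_mem' hf hg := (freeENorm_add_le _ _).trans_lt (ENNReal.add_lt_top.2 ⟨hf, hg⟩)
  smul_mem' c f hf := (freeENorm_smul_le c f).trans_lt (ENNReal.mul_lt_top ENNReal.ofReal_lt_top hf)

/-- The Banach lattice of all functions `f : K → ℝ` with `freeENorm K f < ∞`, with the norm
`freeENorm` and the pointwise operations and order. -/
def FinNormFun : Type _ := finNormSubmodule K

namespace FinNormFun

instance : AddCommGroup (FinNormFun K) := inferInstanceAs (AddCommGroup (finNormSubmodule K))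

instance : Module ℝ (FinNormFun K) := inferInstanceAs (Module ℝ (finNormSubmodule K))

variable {K}

/-- The underlying function. -/
def toFun : FinNormFun K →ₗ[ℝ] (K → ℝ) := (finNormSubmodule K).subtype

/-- A function of finite norm as an element of the space. -/
def ofFun (f : K → ℝ) (hf : freeENorm K f < ∞) : FinNormFun K := ⟨f, hf⟩

theorem toFun_ofFun (f : K → ℝ) (hf : freeENorm K f < ∞) : toFun (ofFun f hf) = f := rfl

theorem toFun_injective : Function.Injective (toFun : FinNormFun K → K → ℝ) :=
  Subtype.val_injective

theorem freeENorm_lt_top (f : FinNormFun K) : freeENorm K (toFun f) < ∞ := Subtype.property f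

theorem freeENorm_sup_lt_top {f g : K → ℝ} (hf : freeENorm K f < ∞) (hg : freeENorm K g < ∞) :
    freeENorm K (f ⊔ g) < ∞ := by
  have hf' : freeENorm K |f| < ∞ := (freeENorm_mono fun x => by simp).trans_lt hf
  have hg' : freeENorm K |g| < ∞ := (freeENorm_mono fun x => by simp).trans_lt hg
  refine lt_of_le_of_lt ((freeENorm_mono fun x => ?_).trans (freeENorm_add_le |f| |g|))
    (ENNReal.add_lt_top.2 ⟨hf', hg'⟩)
  simp only [Pi.sup_apply, Pi.add_apply, Pi.abs_apply]
  rw [abs_of_nonneg (add_nonneg (abs_nonneg (f x)) (abs_nonneg (g x)))]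
  exact abs_max_le_max_abs_abs.trans (max_le_add_of_nonneg (abs_nonneg _) (abs_nonneg _))

theorem freeENorm_inf_lt_top {f g : K → ℝ} (hf : freeENorm K f < ∞) (hg : freeENorm K g < ∞) :
    freeENorm K (f ⊓ g) < ∞ := by
  have hf' : freeENorm K (-f) < ∞ := (freeENorm_mono fun x => by simp).trans_lt hf
  have hg' : freeENorm K (-g) < ∞ := (freeENorm_mono fun x => by simp).trans_lt hg
  refine (freeENorm_mono fun x => ?_).trans_lt (freeENorm_sup_lt_top hf' hg')
  rw [← abs_neg]
  simp [neg_inf]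

instance : Lattice (FinNormFun K) :=
  Subtype.lattice (P := fun f => f ∈ finNormSubmodule K)
    (fun _ _ hf hg => freeENorm_sup_lt_top hf hg) (fun _ _ hf hg => freeENorm_inf_lt_top hf hg)

theorem toFun_sup (f g : FinNormFun K) : toFun (f ⊔ g) = toFun f ⊔ toFun g := rfl

theorem toFun_inf (f g : FinNormFun K) : toFun (f ⊓ g) = toFun f ⊓ toFun g := rfl

theorem toFun_le_toFun {f g : FinNormFun K} : toFun f ≤ toFun g ↔ f ≤ g := Iff.rfl

noncomputable instance : Norm (FinNormFun K) := ⟨fun f => (freeENorm K (toFun f)).toReal⟩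

theorem norm_def (f : FinNormFun K) : ‖f‖ = (freeENorm K (toFun f)).toReal := rfl

theorem abs_apply_le_norm (f : FinNormFun K) (x : K) : |toFun f x| ≤ ‖f‖ := by
  rw [norm_def, ← ENNReal.ofReal_le_iff_le_toReal (freeENorm_lt_top f).ne]
  exact ofReal_abs_le_freeENorm _ _

theorem normCore : NormedSpace.Core ℝ (FinNormFun K) where
  norm_nonneg f := ENNReal.toReal_nonneg
  norm_triangle f g := by
    rw [norm_def, norm_def, norm_def,
      ← ENNReal.toReal_add (freeENorm_lt_top f).ne (freeENorm_lt_top g).ne, map_add]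
    exact ENNReal.toReal_mono
      (ENNReal.add_lt_top.2 ⟨freeENorm_lt_top f, freeENorm_lt_top g⟩).ne (freeENorm_add_le _ _)
  norm_smul c f := by
    have key : ∀ (c : ℝ) (f : FinNormFun K), ‖c • f‖ ≤ ‖c‖ * ‖f‖ := fun c f => by
      rw [norm_def, norm_def, map_smul, Real.norm_eq_abs, ← ENNReal.toReal_ofReal (abs_nonneg c),
        ← ENNReal.toReal_mul]
      exact ENNReal.toReal_mono
        (ENNReal.mul_lt_top ENNReal.ofReal_lt_top (freeENorm_lt_top f)).ne
        (freeENorm_smul_le c _)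
    refine le_antisymm (key c f) ?_
    rcases eq_or_ne c 0 with rfl | hc
    · rw [norm_zero, zero_mul]
      exact ENNReal.toReal_nonneg
    · have h := key c⁻¹ (c • f)
      rw [inv_smul_smul₀ hc, norm_inv] at h
      rwa [← le_inv_mul_iff₀ (norm_pos_iff.2 hc)]
  norm_eq_zero_iff f := by
    constructor
    · intro h
      refine toFun_injective (funext fun x => ?_)
      have := abs_apply_le_norm f x
      rw [h] at this
      simpa using abs_nonpos_iff.1 this
    · rintro rfl
      rw [norm_def, map_zero, freeENorm_zero, ENNReal.toReal_zero]

noncomputable instance : NormedAddCommGroup (FinNormFun K) := NormedAddCommGroup.ofCore normCore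

noncomputable instance : NormedSpace ℝ (FinNormFun K) := NormedSpace.ofCore normCore

theorem freeENorm_le_of_norm_le {f : FinNormFun K} {c : ℝ} (h : ‖f‖ ≤ c) :
    freeENorm K (toFun f) ≤ ENNReal.ofReal c := by
  rw [← ENNReal.ofReal_toReal (freeENorm_lt_top f).ne]
  exact ENNReal.ofReal_le_ofReal h

theorem norm_le_of_freeENorm_le {f : FinNormFun K} {c : ℝ} (hc : 0 ≤ c)
    (h : freeENorm K (toFun f) ≤ ENNReal.ofReal c) : ‖f‖ ≤ c :=
  ENNReal.toReal_le_of_le_ofReal hc h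

instance : CompleteSpace (FinNormFun K) := by
  refine Metric.complete_of_cauchySeq_tendsto fun u hu => ?_
  have hpt : ∀ x, ∃ l, Filter.Tendsto (fun n => toFun (u n) x) Filter.atTop (nhds l) := by
    intro x
    refine cauchySeq_tendsto_of_complete (Metric.cauchySeq_iff.2 fun ε hε => ?_)
    obtain ⟨N, hN⟩ := Metric.cauchySeq_iff.1 hu ε hε
    refine ⟨N, fun m hm n hn => lt_of_le_of_lt ?_ (hN m hm n hn)⟩
    rw [Real.dist_eq, dist_eq_norm]
    have := abs_apply_le_norm (u m - u n) x
    rwa [map_sub] at this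
  choose g hg using hpt
  have key : ∀ ε : ℝ, 0 < ε → ∃ N, ∀ m ≥ N,
      freeENorm K (toFun (u m) - g) ≤ ENNReal.ofReal ε := by
    intro ε hε
    obtain ⟨N, hN⟩ := Metric.cauchySeq_iff.1 hu ε hε
    refine ⟨N, fun m hm => freeENorm_le fun n r x hx => ?_⟩
    have hlim : Filter.Tendsto
        (fun k => ∑ i, ENNReal.ofReal |r i * (toFun (u m) - toFun (u k)) (x i)|) Filter.atTop
        (nhds (∑ i, ENNReal.ofReal |r i * (toFun (u m) - g) (x i)|)) := by
      refine tendsto_finsetSum _ fun i _ => (ENNReal.continuous_ofReal.tendsto _).comp ?_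
      exact (((hg (x i)).const_sub _).const_mul _).abs
    refine le_of_tendsto hlim (Filter.eventually_atTop.2 ⟨N, fun k hk => ?_⟩)
    have h1 : freeENorm K (toFun (u m - u k)) ≤ ENNReal.ofReal ε :=
      freeENorm_le_of_norm_le (by rw [← dist_eq_norm]; exact (hN m hm k hk).le)
    rw [map_sub] at h1
    exact (le_freeENorm _ hx).trans h1
  have hgtop : freeENorm K g < ∞ := by
    obtain ⟨N, hN⟩ := key 1 one_pos
    have hd : toFun (u N) - g ∈ finNormSubmodule K :=
      (hN N le_rfl).trans_lt ENNReal.ofReal_lt_top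
    have h2 := (finNormSubmodule K).sub_mem (freeENorm_lt_top (u N)) hd
    rwa [sub_sub_cancel] at h2
  refine ⟨ofFun g hgtop, Metric.tendsto_atTop.2 fun ε hε => ?_⟩
  obtain ⟨N, hN⟩ := key (ε / 2) (half_pos hε)
  refine ⟨N, fun n hn => lt_of_le_of_lt ?_ (half_lt_self hε)⟩
  rw [dist_eq_norm]
  exact norm_le_of_freeENorm_le (half_pos hε).le (by rw [map_sub, toFun_ofFun]; exact hN n hn)

instance : IsBanachLattice (FinNormFun K) where
  add_le_add_left a b h c := by
    rw [← toFun_le_toFun] at *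
    rw [map_add, map_add]
    exact add_le_add_left h _
  smul_le_smul_of_nonneg_left r hr a b h := by
    rw [← toFun_le_toFun] at *
    rw [map_smul, map_smul]
    exact smul_le_smul_of_nonneg_left h hr
  smul_le_smul_of_nonneg_right b hb r s h := by
    rw [← toFun_le_toFun] at *
    rw [map_smul, map_smul]
    rw [map_zero] at hb
    exact smul_le_smul_of_nonneg_right h hb
  solid f g h := by
    refine ENNReal.toReal_mono (freeENorm_lt_top g).ne (freeENorm_mono fun x => ?_)
    exact h x

end FinNormFun

/-- The evaluation function at `a` as an element of the Banach lattice of functions of finite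
norm. -/
def freeEval (a : A) : FinNormFun K :=
  FinNormFun.ofFun (evalFun K a) ((freeENorm_evalFun_le a).trans_lt ENNReal.one_lt_top)

/-- The Banach lattice generated by the evaluation functions inside the Banach lattice of all
functions of finite norm on `K`. (For `K = Set.univ` this is the free Banach lattice `FBL(A)`
generated by the set `A`.) -/
abbrev FreeFunLattice : Type _ :=
  (ClosedSublattice.generated (Set.range (freeEval K))).Carrier

end FunctionSpace

/-- The set `𝕃*` of all lattice homomorphisms `𝕃 → [-1, 1]`. -/
def latticeDual (L : Type*) [Lattice L] : Set (L → Set.Icc (-1 : ℝ) 1) :=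
  {f | (∀ x y, f (x ⊔ y) = f x ⊔ f y) ∧ ∀ x y, f (x ⊓ y) = f x ⊓ f y}

/-- The free Banach lattice `FBL_*⟨𝕃⟩` generated by the lattice `𝕃`: the Banach lattice generated
by the evaluations on `𝕃*` inside the Banach lattice of all functions `f : 𝕃* → ℝ` with
`‖f‖_* < ∞`. -/
abbrev FBLStar (L : Type*) [Lattice L] : Type _ := FreeFunLattice (latticeDual L)

open Filter Topology

/-! ### Chains in `ℕ × ℕ` and a Banach lattice of functions on `ℕ × ℕ` -/

/-! Suppose `x` is increasing and unbounded. Let `c i` be the indicator of `[x i, ∞)`, a point of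
`𝕃*`, and let `w n` be the evaluation at `x n`. Unboundedness gives `c i → 0` pointwise, so `f ↦ (f
(c i))` maps the free lattice into `c₀` (`tendsto_freeVal`). The `w n` increase, have norm at most
`1`, and `w n` equals `1` at `c n`. The decreasing case differs only in signs.

Let `X` consist of functions on `ℕ × ℕ` whose norm dominates sums along chains, and `J` of those
null along each row. A single null sequence `a` lifts boundedly to a function eventually equal to `a
i` on row `i`: if row `i` starts so late that `a` has halved by then, the terms met along a chain
decay geometrically (`sum_chain_le`). Passing to `X / J` gives a homomorphism `T` on the free
lattice (`exists_hom_quot`).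

`T` has no lift `S`, whatever its norm. The `S (w n)` would be increasing and bounded, with `S (w
i)` eventually at least `1/2` on row `i`. Choosing each row beyond the column used in the previous
one builds arbitrarily long chains along which a single `S (w n)` stays at least `1/2`
(`not_bounded_of_rows`). -/

/-- Two sequences `i`, `k` of natural numbers with `k s < i t` whenever `s < t`; the points
`(i s, k s)` are then said to form a chain in `ℕ × ℕ`. -/
def IsChainSeq (i k : ℕ → ℕ) : Prop := ∀ s t, s < t → k s < i t

/-- The functions on `ℕ × ℕ` with values in `[0, 1]` whose sum along each chain is at most `1`. -/
def ChainTest : Type v :=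
  -- If `k < i`, repeating `(i, k)` forever is a chain, so every test vanishes there: only points
  -- with `i ≤ k` matter.
  ULift.{v} {b : ℕ → ℕ → Set.Icc (-1 : ℝ) 1 // (∀ i k, (0 : ℝ) ≤ b i k) ∧
    ∀ i k, IsChainSeq i k → ∀ n, ∑ s : Fin n, (b (i s) (k s) : ℝ) ≤ 1}

/-- The point `(i, k)` as an evaluation on `ChainTest`. -/
def chainPoint (i k : ℕ) : ChainTest.{v} → Set.Icc (-1 : ℝ) 1 := fun b => b.down.1 i k

/-- The set of all evaluations at points of `ℕ × ℕ`. -/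
def chainPoints : Set (ChainTest.{v} → Set.Icc (-1 : ℝ) 1) :=
  Set.range fun p : ℕ × ℕ => chainPoint p.1 p.2

/-- The Banach lattice of functions on `ℕ × ℕ` with bounded sums along chains. -/
abbrev ChainSpace : Type v := FinNormFun chainPoints.{v}

namespace ChainSpace

/-- The value of `f` at `(i, k)`. -/
noncomputable def val (i k : ℕ) : ChainSpace.{v} →ₗ[ℝ] ℝ :=
  (LinearMap.proj (⟨chainPoint i k, (i, k), rfl⟩ : chainPoints.{v})).comp FinNormFun.toFun

theorem val_sup (i k : ℕ) (f g : ChainSpace.{v}) : val i k (f ⊔ g) = val i k f ⊔ val i k g := rfl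

theorem val_inf (i k : ℕ) (f g : ChainSpace.{v}) : val i k (f ⊓ g) = val i k f ⊓ val i k g := rfl

theorem val_mono (i k : ℕ) {f g : ChainSpace.{v}} (h : f ≤ g) : val i k f ≤ val i k g :=
  FinNormFun.toFun_le_toFun.2 h _

theorem val_abs (i k : ℕ) (f : ChainSpace.{v}) : val i k |f| = |val i k f| := by
  rw [abs, val_sup, map_neg, abs]

theorem abs_val_le_norm (i k : ℕ) (f : ChainSpace.{v}) : |val i k f| ≤ ‖f‖ :=
  FinNormFun.abs_apply_le_norm _ _

/-- The defining bound on the tests says exactly that unit weights on a chain are admissible in the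
supremum defining the norm. -/
theorem sum_abs_val_le_norm {i k : ℕ → ℕ} (h : IsChainSeq i k) (n : ℕ) (f : ChainSpace.{v}) :
    ∑ s : Fin n, |val (i s) (k s) f| ≤ ‖f‖ := by
  have key := le_freeENorm (K := chainPoints.{v}) (FinNormFun.toFun f) (n := n) (r := fun _ => 1)
    (x := fun s => ⟨chainPoint (i s) (k s), (i s, k s), rfl⟩) fun b => by
      refine le_of_eq_of_le (Finset.sum_congr rfl fun s _ => ?_) (b.down.2.2 i k h n)
      rw [one_mul]
      exact abs_of_nonneg (b.down.2.1 _ _)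
  rw [← ENNReal.ofReal_sum_of_nonneg fun i _ => abs_nonneg _] at key
  rw [FinNormFun.norm_def, ← ENNReal.ofReal_le_iff_le_toReal (FinNormFun.freeENorm_lt_top f).ne]
  simp only [one_mul] at key
  exact key

/-- The closed ideal of the functions that tend to zero along each row of `ℕ × ℕ`. -/
noncomputable def rowNull : ClosedIdeal ChainSpace.{v} where
  carrier := {f | ∀ i, Tendsto (fun k => val i k f) atTop (𝓝 0)}
  zero_mem' i := by simp
  add_mem' hf hg i := by simpa using (hf i).add (hg i)
  smul_mem' c f hf i := by simpa using (hf i).const_mul c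
  isClosed' := by
    refine isClosed_of_closure_subset fun f hf i => Metric.tendsto_atTop.2 fun ε hε => ?_
    obtain ⟨g, hg, hfg⟩ := Metric.mem_closure_iff.1 hf (ε / 2) (half_pos hε)
    obtain ⟨N, hN⟩ := Metric.tendsto_atTop.1 (hg i) (ε / 2) (half_pos hε)
    refine ⟨N, fun k hk => ?_⟩
    have h1 := hN k hk
    have h2 := abs_val_le_norm i k (f - g)
    rw [dist_eq_norm] at hfg
    rw [Real.dist_0_eq_abs] at h1 ⊢
    have h3 := abs_add_le (val i k (f - g)) (val i k g)
    rw [map_sub, sub_add_cancel] at h3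
    rw [map_sub] at h2
    linarith
  solid' := fun f hf g hgf i => by
    refine squeeze_zero_norm (fun k => ?_) (by simpa using (hf i).abs)
    rw [Real.norm_eq_abs, ← val_abs, ← val_abs]
    exact val_mono i k hgf

theorem mem_rowNull {f : ChainSpace.{v}} :
    f ∈ rowNull.toSubmodule ↔ ∀ i, Tendsto (fun k => val i k f) atTop (𝓝 0) := Iff.rfl

/-- The rows of `f` are eventually equal to the terms of the sequence `a`. -/
def Extends (f : ChainSpace.{v}) (a : ℕ → ℝ) : Prop := ∀ i, ∀ᶠ k in atTop, val i k f = a i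

/-- Makes the class of an extension independent of all choices; every algebraic property of the map
into the quotient reduces to this. -/
theorem Extends.proj_eq {f g : ChainSpace.{v}} {a : ℕ → ℝ} (hf : Extends f a) (hg : Extends g a) :
    rowNull.proj f = rowNull.proj g := by
  rw [ClosedIdeal.proj_eq_iff, mem_rowNull]
  refine fun i => tendsto_const_nhds.congr' ?_
  filter_upwards [hf i, hg i] with k h1 h2
  rw [map_sub, h1, h2, sub_self]

/-! ### Bounded lifts of null sequences -/

/-- Once a chain meets a nonzero entry of row `i`, its later rows lie beyond `κ i`, where `a` is at
most half of `a i`. Hence the sum is dominated by `m/2 + m/4 + ⋯`. The bound `m` varies so that the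
induction can halve it. -/
theorem sum_chain_le {a : ℕ → ℝ} (ha : ∀ i, 0 ≤ a i) {κ : ℕ → ℕ}
    (hκ : ∀ i, 0 < a i → ∀ j ≥ κ i, a j ≤ a i / 2) (n : ℕ) {i k : ℕ → ℕ} (h : IsChainSeq i k)
    {m : ℝ} (hm : 0 ≤ m) (him : ∀ s, a (i s) ≤ m) :
    ∑ s : Fin n, (if κ (i s) ≤ k s then a (i s) / 2 else 0) ≤ m := by
  induction n generalizing i k m with
  | zero => simpa using hm
  | succ n ih =>
    have h' : IsChainSeq (fun s => i (s + 1)) (fun s => k (s + 1)) :=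
      fun s t hst => h _ _ (Nat.succ_lt_succ hst)
    have hsum : ∑ s : Fin (n + 1), (if κ (i s) ≤ k s then a (i s) / 2 else 0) =
        (if κ (i 0) ≤ k 0 then a (i 0) / 2 else 0) +
          ∑ s : Fin n, (if κ (i (s + 1)) ≤ k (s + 1) then a (i (s + 1)) / 2 else 0) :=
      Fin.sum_univ_succ _
    rw [hsum]
    have h0 := him 0
    rcases (ha (i 0)).eq_or_lt with hz | hz
    · have := ih h' hm fun s => him (s + 1)
      rw [← hz]
      simpa using this
    · split_ifs with hk
      -- The first entry costs at most `m / 2`, and the tail is bounded by the remaining `m / 2`.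
      · have := ih h' (m := m / 2) (by linarith) fun s => by
          have := hκ (i 0) hz (i (s + 1)) (hk.trans (h 0 (s + 1) s.succ_pos).le)
          linarith
        linarith
      · rw [zero_add]
        exact ih h' hm fun s => him (s + 1)

theorem exists_extends_of_nonneg_of_le_one {a : ℕ → ℝ} (ha : Tendsto a atTop (𝓝 0))
    (h0 : ∀ i, 0 ≤ a i) (h1 : ∀ i, a i ≤ 1) :
    ∃ f : ChainSpace.{v}, Extends f a ∧ ‖f‖ ≤ 2 := by
  -- Rows with `a i = 0` may start anywhere, since their entries vanish.
  have hex : ∀ i, ∃ κ : ℕ, 0 < a i → ∀ j ≥ κ, a j ≤ a i / 2 := by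
    intro i
    by_cases hi : 0 < a i
    · obtain ⟨N, hN⟩ := eventually_atTop.1 (ha.eventually_le_const (half_pos hi))
      exact ⟨N, fun _ => hN⟩
    · exact ⟨0, fun h => absurd h hi⟩
  choose κ hκ using hex
  -- Half of the wanted function is itself a test, so evaluation at it has norm at most `1`;
  -- doubling gives the extension.
  let b : ChainTest.{v} := ⟨⟨fun i k => ⟨if κ i ≤ k then a i / 2 else 0, by
      have := h0 i
      have := h1 i
      split_ifs <;> constructor <;> linarith⟩, fun i k => by
      have := h0 i
      dsimp only
      split_ifs <;> linarith, fun i k hik n =>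
      sum_chain_le h0 hκ n hik zero_le_one fun s => h1 _⟩⟩
  refine ⟨(2 : ℝ) • freeEval _ b, fun i => ?_, ?_⟩
  · filter_upwards [eventually_ge_atTop (κ i)] with k hk
    have hv : val i k (freeEval _ b) = if κ i ≤ k then a i / 2 else 0 := rfl
    rw [map_smul, hv, if_pos hk, smul_eq_mul]
    ring
  · have hn : ‖(freeEval _ b : ChainSpace.{v})‖ ≤ 1 :=
      FinNormFun.norm_le_of_freeENorm_le zero_le_one
        ((freeENorm_evalFun_le b).trans_eq ENNReal.ofReal_one.symm)
    rw [norm_smul, Real.norm_ofNat]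
    linarith

/-- The positive and negative parts of `a / C` are lifted separately, each with norm at most `2`. -/
theorem exists_extends {a : ℕ → ℝ} (ha : Tendsto a atTop (𝓝 0)) {C : ℝ} (hC : ∀ i, |a i| ≤ C) :
    ∃ f : ChainSpace.{v}, Extends f a ∧ ‖f‖ ≤ 4 * C := by
  rcases ((abs_nonneg _).trans (hC 0)).eq_or_lt with rfl | hpos
  · refine ⟨0, fun i => Eventually.of_forall fun k => ?_, by simp⟩
    rw [map_zero, abs_nonpos_iff.1 (hC i)]
  have key : ∀ b : ℕ → ℝ, Tendsto b atTop (𝓝 0) → (∀ i, b i ≤ C) →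
      ∃ f : ChainSpace.{v}, Extends f (fun i => max (b i / C) 0) ∧ ‖f‖ ≤ 2 := fun b hb hbC =>
    exists_extends_of_nonneg_of_le_one
      (by simpa using (hb.div_const C).max (tendsto_const_nhds (x := (0 : ℝ))))
      (fun i => le_max_right _ _) fun i => max_le ((div_le_one hpos).2 (hbC i)) zero_le_one
  obtain ⟨f, hf, hfn⟩ := key a ha fun i => (le_abs_self _).trans (hC i)
  obtain ⟨g, hg, hgn⟩ := key (fun i => -a i) (by simpa using ha.neg)
    fun i => (neg_le_abs _).trans (hC i)
  refine ⟨C • (f - g), fun i => ?_, ?_⟩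
  · filter_upwards [hf i, hg i] with k h1 h2
    rw [map_smul, map_sub, h1, h2, neg_div, smul_eq_mul]
    have h3 := max_zero_sub_eq_self (a i / C)
    rw [max_comm, max_comm (0 : ℝ)] at h3
    rw [h3, mul_div_cancel₀ _ hpos.ne']
  · rw [norm_smul, Real.norm_of_nonneg hpos.le]
    nlinarith [norm_sub_le f g]

end ChainSpace

/-! ### Homomorphisms into the quotient -/

section Hom

open ChainSpace

variable {A : Type u} {K : Set (A → Set.Icc (-1 : ℝ) 1)}

/-- The value at a point of `K` of an element of the Banach lattice generated by the
evaluations. -/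
noncomputable def freeVal (c : K) : FreeFunLattice K →ₗ[ℝ] ℝ :=
  ((LinearMap.proj c).comp FinNormFun.toFun).comp (ClosedSublattice.incl _).toLinearMap

theorem freeVal_sup (c : K) (f g : FreeFunLattice K) :
    freeVal c (f ⊔ g) = freeVal c f ⊔ freeVal c g := rfl

theorem freeVal_inf (c : K) (f g : FreeFunLattice K) :
    freeVal c (f ⊓ g) = freeVal c f ⊓ freeVal c g := rfl

theorem abs_freeVal_le_norm (c : K) (f : FreeFunLattice K) : |freeVal c f| ≤ ‖f‖ :=
  FinNormFun.abs_apply_le_norm _ _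

/-- The closed vector sublattice of the functions that tend to zero along a sequence of points. -/
noncomputable def nullAlong (c : ℕ → K) : ClosedSublattice (FinNormFun K) where
  carrier := {f | Tendsto (fun i => FinNormFun.toFun f (c i)) atTop (𝓝 0)}
  zero_mem' := by simp
  add_mem' hf hg := by simpa using Tendsto.add hf hg
  smul_mem' r f hf := by simpa using Tendsto.const_mul r hf
  sup_mem' f g hf hg := by simpa using! Tendsto.sup_nhds hf hg
  inf_mem' f g hf hg := by simpa using! Tendsto.inf_nhds hf hg
  isClosed' := by
    refine isClosed_of_closure_subset fun f hf => Metric.tendsto_atTop.2 fun ε hε => ?_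
    obtain ⟨g, hg, hfg⟩ := Metric.mem_closure_iff.1 hf (ε / 2) (half_pos hε)
    obtain ⟨N, hN⟩ := Metric.tendsto_atTop.1 hg (ε / 2) (half_pos hε)
    refine ⟨N, fun k hk => ?_⟩
    have h1 := hN k hk
    have h2 := FinNormFun.abs_apply_le_norm (f - g) (c k)
    rw [dist_eq_norm] at hfg
    rw [Real.dist_0_eq_abs] at h1 ⊢
    rw [map_sub, Pi.sub_apply] at h2
    have h3 := abs_add_le (FinNormFun.toFun f (c k) - FinNormFun.toFun g (c k))
      (FinNormFun.toFun g (c k))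
    rw [sub_add_cancel] at h3
    linarith

/-- Nullity along `c` defines a closed sublattice, so it passes from the generators to everything
they generate. -/
theorem tendsto_freeVal {c : ℕ → K} (hc : ∀ x, Tendsto (fun i => ((c i).1 x : ℝ)) atTop (𝓝 0))
    (f : FreeFunLattice K) : Tendsto (fun i => freeVal (c i) f) atTop (𝓝 0) :=
  ClosedSublattice.generated_le (V := nullAlong c) (by rintro _ ⟨x, rfl⟩; exact hc x)
    (ClosedSublattice.incl_mem _ f)

/-- The chosen extensions need not depend linearly on `f`, but their classes do, and they respect
the lattice operations because these are computed entrywise. -/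
theorem exists_hom_quot {c : ℕ → K} (hc : ∀ x, Tendsto (fun i => ((c i).1 x : ℝ)) atTop (𝓝 0)) :
    ∃ T : FreeFunLattice K →L[ℝ] (rowNull.{v}).Quot, IsBLHom T ∧
      ∀ f, ∃ g, Extends g (fun i => freeVal (c i) f) ∧ rowNull.proj g = T f := by
  choose g hg hgn using fun f : FreeFunLattice K =>
    exists_extends.{v} (tendsto_freeVal hc f) fun i => abs_freeVal_le_norm (c i) f
  let T₀ : FreeFunLattice K →ₗ[ℝ] (rowNull.{v}).Quot :=
    { toFun := fun f => rowNull.proj (g f)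
      map_add' := fun f f' => by
        rw [← map_add]
        refine (hg _).proj_eq fun i => ?_
        filter_upwards [hg f i, hg f' i] with k h1 h2
        rw [map_add, map_add, h1, h2]
      map_smul' := fun r f => by
        rw [RingHom.id_apply, ← map_smul]
        refine (hg _).proj_eq fun i => ?_
        filter_upwards [hg f i] with k h1
        rw [map_smul, map_smul, h1] }
  refine ⟨T₀.mkContinuous 4 fun f => (ClosedIdeal.norm_proj_le _ _).trans (hgn f),
    ⟨fun f f' => ?_, fun f f' => ?_⟩, fun f => ⟨g f, hg f, rfl⟩⟩
  · change rowNull.proj (g _) = rowNull.proj (g f) ⊔ rowNull.proj (g f')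
    rw [← ClosedIdeal.proj_sup]
    refine (hg _).proj_eq fun i => ?_
    filter_upwards [hg f i, hg f' i] with k h1 h2
    rw [val_sup, freeVal_sup, h1, h2]
  · change rowNull.proj (g _) = rowNull.proj (g f) ⊓ rowNull.proj (g f')
    rw [← ClosedIdeal.proj_inf]
    refine (hg _).proj_eq fun i => ?_
    filter_upwards [hg f i, hg f' i] with k h1 h2
    rw [val_inf, freeVal_inf, h1, h2]

/-! ### The obstruction to lifting -/

/-- An increasing sequence in `ChainSpace` whose `n`-th term is eventually at least `1/2` on each of
the rows `0, …, n` is not bounded in norm. -/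
theorem not_bounded_of_rows {w : ℕ → ChainSpace.{v}} (hw : Monotone w)
    (h : ∀ i, ∀ᶠ k in atTop, 1 / 2 ≤ val i k (w i)) (C : ℝ) : ∃ n, C < ‖w n‖ := by
  choose κ hκ using fun i => eventually_atTop.1 (h i)
  -- Passing `κ j` makes the points `(i s, κ (i s))` a chain; passing `j` makes the rows strictly
  -- increase.
  let i : ℕ → ℕ := fun s => Nat.rec 0 (fun _ j => max (κ j) j + 1) s
  have hi : ∀ s, i (s + 1) = max (κ (i s)) (i s) + 1 := fun s => rfl
  have hmono : StrictMono i := strictMono_nat_of_lt_succ fun s => by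
    rw [hi]
    exact Nat.lt_succ_of_le (le_max_right _ _)
  have hchain : IsChainSeq i fun s => κ (i s) := fun s t hst => by
    refine lt_of_lt_of_le ?_ (hmono.monotone (Nat.succ_le_of_lt hst))
    rw [Nat.succ_eq_add_one, hi]
    exact Nat.lt_succ_of_le (le_max_left _ _)
  obtain ⟨n, hn⟩ := exists_nat_gt (2 * C)
  refine ⟨i n, lt_of_lt_of_le ?_ (sum_abs_val_le_norm hchain n _)⟩
  calc C < ∑ s : Fin n, (1 / 2 : ℝ) := by
        rw [Finset.sum_const, Finset.card_univ, Fintype.card_fin, nsmul_eq_mul]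
        linarith
    _ ≤ _ := Finset.sum_le_sum fun s _ => by
        refine le_trans ?_ (le_abs_self _)
        -- Monotonicity carries the bound for `w (i s)` to the single later term `w (i n)`.
        exact (hκ (i s) _ le_rfl).trans (val_mono _ _ (hw (hmono.monotone s.2.le)))

/-- If a sequence of points tends to zero at each generator and there is a bounded increasing
sequence of elements whose `n`-th term takes the value `1` at the points with index at most `n`,
then the Banach lattice generated by the evaluations is not projective. -/
theorem not_isProjectiveBL_of_seq {c : ℕ → K}
    (hc : ∀ x, Tendsto (fun i => ((c i).1 x : ℝ)) atTop (𝓝 0)) {w : ℕ → FreeFunLattice K}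
    (hw : Monotone w) (hb : ∀ n, ‖w n‖ ≤ 1) (h1 : ∀ n, freeVal (c n) (w n) = 1) :
    ¬ IsProjectiveBL.{u, v} (FreeFunLattice K) := by
  intro hP
  obtain ⟨T, hT, hTg⟩ := exists_hom_quot.{u, v} hc
  -- The value `ε = 1` is arbitrary: only the boundedness of `S` is needed.
  obtain ⟨S, hS, hST, -⟩ := hP ChainSpace.{v} rowNull T hT 1 one_pos
  have hSmono : Monotone fun n => S (w n) := fun m n hmn => by
    have h := hS.1 (w m) (w n)
    rw [sup_eq_right.2 (hw hmn)] at h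
    exact sup_eq_right.1 h.symm
  obtain ⟨n, hn⟩ := not_bounded_of_rows hSmono (fun i => by
    obtain ⟨g, hg, hgT⟩ := hTg (w i)
    rw [← hST, ContinuousLinearMap.comp_apply, eq_comm, ClosedIdeal.proj_eq_iff, mem_rowNull] at hgT
    -- On row `i`, `g` is eventually `1` and `S (w i) - g` tends to zero, so `S (w i)` is eventually
    -- at least `1/2`.
    filter_upwards [hg i, (hgT i).eventually_const_le (show (-1 / 2 : ℝ) < 0 by norm_num)]
      with k h2 h3
    rw [map_sub, h2, h1] at h3
    linarith) ‖S‖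
  exact hn.not_ge ((S.le_opNorm _).trans (mul_le_of_le_one_right (norm_nonneg _) (hb n)))

end Hom

/-! ### Linear orders -/

/-- The evaluation at `x` as an element of the free Banach lattice. -/
noncomputable def freeGen {A : Type u} (K : Set (A → Set.Icc (-1 : ℝ) 1)) (x : A) :
    FreeFunLattice K :=
  ⟨freeEval _ x, ClosedSublattice.subset_generated _ ⟨x, rfl⟩⟩

theorem freeVal_freeGen {A : Type u} {K : Set (A → Set.Icc (-1 : ℝ) 1)} (c : K) (x : A) :
    freeVal c (freeGen K x) = c.1 x := rfl

theorem norm_freeGen_le {A : Type u} {K : Set (A → Set.Icc (-1 : ℝ) 1)} (x : A) :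
    ‖freeGen K x‖ ≤ 1 :=
  FinNormFun.norm_le_of_freeENorm_le zero_le_one
    ((freeENorm_evalFun_le x).trans_eq ENNReal.ofReal_one.symm)

theorem mem_latticeDual_of_monotone {L : Type u} [LinearOrder L] {f : L → Set.Icc (-1 : ℝ) 1}
    (hf : Monotone f) : f ∈ latticeDual L := ⟨hf.map_sup, hf.map_inf⟩

theorem freeGen_mono {L : Type u} [LinearOrder L] : Monotone (freeGen (latticeDual L)) := by
  intro x y hxy c
  have h := c.2.1 x y
  rw [sup_eq_right.2 hxy] at h
  exact Subtype.coe_le_coe.2 (sup_eq_right.1 h.symm)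

theorem not_isProjectiveBL_of_unbounded_above {L : Type u} [LinearOrder L] {x : ℕ → L}
    (hx : StrictMono x) (hb : ¬ BddAbove (Set.range x)) :
    ¬ IsProjectiveBL.{u, v} (FBLStar L) := by
  let c : ℕ → latticeDual L := fun i =>
    ⟨fun y => if x i ≤ y then ⟨1, by norm_num⟩ else ⟨0, by norm_num⟩,
      mem_latticeDual_of_monotone fun y z h => by
      rw [← Subtype.coe_le_coe]
      split_ifs with h1 h2 <;> first | exact absurd (h1.trans h) h2 | norm_num⟩
  refine not_isProjectiveBL_of_seq (c := c) (fun y => ?_)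
    (freeGen_mono.comp hx.monotone) (fun n => norm_freeGen_le _) fun n => ?_
  -- Some `x n` exceeds `y`, so `c i` vanishes at `y` for all `i ≥ n`.
  · obtain ⟨_, ⟨n, rfl⟩, hn⟩ := not_bddAbove_iff.1 hb y
    refine tendsto_const_nhds.congr' ?_
    filter_upwards [eventually_ge_atTop n] with i hi
    have : ¬ x i ≤ y := (hn.trans_le (hx.monotone hi)).not_ge
    simp [c, this]
  · rw [Function.comp_apply, freeVal_freeGen]
    simp [c]

theorem not_isProjectiveBL_of_unbounded_below {L : Type u} [LinearOrder L] {x : ℕ → L}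
    (hx : StrictAnti x) (hb : ¬ BddBelow (Set.range x)) :
    ¬ IsProjectiveBL.{u, v} (FBLStar L) := by
  -- The value `-1` on the lower ray keeps `c i` increasing; the sign is compensated by taking `w n`
  -- to be minus the evaluation at `x n`.
  let c : ℕ → latticeDual L := fun i =>
    ⟨fun y => if y ≤ x i then ⟨-1, by norm_num⟩ else ⟨0, by norm_num⟩,
      mem_latticeDual_of_monotone fun y z h => by
      rw [← Subtype.coe_le_coe]
      split_ifs with h1 h2 h3 <;> first | exact absurd (h.trans h3) h1 | norm_num⟩
  refine not_isProjectiveBL_of_seq (c := c) (w := fun n => -freeGen _ (x n)) (fun y => ?_)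
    (fun m n h => neg_le_neg (freeGen_mono (hx.antitone h)))
    (fun n => (norm_neg _).trans_le (norm_freeGen_le _)) fun n => ?_
  · obtain ⟨_, ⟨n, rfl⟩, hn⟩ := not_bddBelow_iff.1 hb y
    refine tendsto_const_nhds.congr' ?_
    filter_upwards [eventually_ge_atTop n] with i hi
    have : ¬ y ≤ x i := ((hx.antitone hi).trans_lt hn).not_ge
    simp [c, this]
  · rw [map_neg, freeVal_freeGen]
    simp [c]

theorem theorem4p4 (L : Type u) [LinearOrder L] [Infinite L]
    (h : (∃ x : ℕ → L, StrictMono x ∧ ¬ BddAbove (Set.range x)) ∨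
      (∃ x : ℕ → L, StrictAnti x ∧ ¬ BddBelow (Set.range x))) :
    ¬ IsProjectiveBL.{u, v} (FBLStar L) := by
  rcases h with ⟨x, hx, hb⟩ | ⟨x, hx, hb⟩
  · exact not_isProjectiveBL_of_unbounded_above hx hb
  · exact not_isProjectiveBL_of_unbounded_below hx hb
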